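/- We consider first-order logic (FO) with equality and without function symbols and constants; structures have non-empty domains, and $\mathsf{sig}(\varphi)$ is the finite set of predicates that occur in $\varphi$ (equality is not a predicate). A fragment $F$ of FO is a set of FO formulas; the $F$-sentences are the members of $F$ without free variables. A signature $\Sigma$ is a finite set of predicates, and $F(\Sigma)$ is the set of $F$-sentences $\psi$ with $\mathsf{sig}(\psi)\subseteq\Sigma$. For sentences $\varphi_1,\varphi_2$: - $\varphi_1$ *$F(\Sigma)$-entails* $\varphi_2$ if for all $\psi\in F(\Sigma)$, $\varphi_2\models\psi$ implies $\varphi_1\models\psi$; - $\varphi_1,\varphi_2$ are *$F(\Sigma)$-inseparable* if they $F(\Sigma)$-entail each other; - $\varphi_1\wedge\varphi_2$ is an *$F$-conservative extension* of $\varphi_1$ if $\varphi_1$ $F(\mathsf{sig}(\varphi_1))$-entails $\varphi_1\wedge\varphi_2$; - $\varphi_1$ *strongly $F(\Sigma)$-entails* $\varphi_2$ if $\varphi_1$ $F(\Sigma')$-entails $\varphi_2$ for every signature $\Sigma'$ with $\Sigma'\cap\mathsf{sig}(\varphi_2)\subseteq\Sigma$. The guarded fragment GF allows quantification only in the patterns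 $\forall\bar y(\alpha\to\varphi)$ and $\exists\bar y(\alpha\wedge\varphi)$, where $\alpha$ is an atomic formula (possibly an equality) that contains all variables in $\bar y$ and all free variables of $\varphi$. $\mathrm{GF}^k$ is the set of GF formulas that use only $k$ fixed variables and predicates of arity between $1$ and $k$. We say that $F$ *extends* $G$ if every $G$-sentence can be effectively rewritten into a logically equivalent $F$-sentence with the same predicates (for example, if every $G$-sentence is an $F$-sentence). **Theorem.** (1) Let $F$ be any fragment of FO that extends $\mathrm{GF}^3$. Then each of the following problems is undecidable: - conservative extensions: given $F$-sentences $\varphi_1,\varphi_2$, decide whether $\varphi_1\wedge\varphi_2$ is an $F$-conservative extension of $\varphi_1$; - $\Sigma$-inseparability: given $F$-sentences $\varphi_1,\varphi_2$ and a signature $\Sigma$, decide whether $\varphi_1,\varphi_2$ are $F(\Sigma)$-inseparable; - $\Sigma$-entailment: given $F$-sentences $\varphi_1,\varphi_2$ and a signature $\Sigma$, decide whether $\varphi_1$ $F(\Sigma)$-entails $\varphi_2$; - strong $\Sigma$-entailment: given $F$-sentences $\varphi_1,\varphi_2$ and a signature $\Sigma$, decide whether $\varphi_1$ strongly $F(\Sigma)$-entails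 $\varphi_2$. (2) Let $W$ be any fragment of FO that extends $\mathrm{GF}^2$, for example $W=\mathrm{GF}^2$. Then it is undecidable, given $\mathrm{GF}^3$-sentences $\varphi_1,\varphi_2$, whether $\varphi_1\wedge\varphi_2$ is a $W$-conservative extension of $\varphi_1$. Here a problem is undecidable if no algorithm halts with the correct answer on all inputs of the stated form; the behaviour on other inputs is irrelevant. -/

import Mathlib

namespace FOCons

/-- A predicate symbol: a name together with an arity.  There are countably many predicate symbols
of each arity; equality is a logical symbol and not one of them. -/
abbrev PredSym := ℕ × ℕ

/-- Formulas of first-order logic with equality, without function symbols and constants, over the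
variables `0, 1, 2, …`.  The atom `rel n [x₁, …, xₖ]` is `R x₁ … xₖ` for the predicate symbol
`R = (n, k)`. -/
inductive Formula : Type
  | eq (x y : ℕ)
  | rel (n : ℕ) (xs : List ℕ)
  | neg (φ : Formula)
  | and (φ ψ : Formula)
  | or (φ ψ : Formula)
  | imp (φ ψ : Formula)
  | ex (x : ℕ) (φ : Formula)
  | all (x : ℕ) (φ : Formula)

namespace Formula

/-- Gödel numbering of formulas. -/
def toNat : Formula → ℕ
  | eq x y => 8 * Nat.pair x y
  | rel n xs => 8 * Nat.pair n (Encodable.encode xs) + 1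
  | neg φ => 8 * toNat φ + 2
  | and φ ψ => 8 * Nat.pair (toNat φ) (toNat ψ) + 3
  | or φ ψ => 8 * Nat.pair (toNat φ) (toNat ψ) + 4
  | imp φ ψ => 8 * Nat.pair (toNat φ) (toNat ψ) + 5
  | ex x φ => 8 * Nat.pair x (toNat φ) + 6
  | all x φ => 8 * Nat.pair x (toNat φ) + 7

/-- The formula with a given Gödel number. -/
def ofNat (c : ℕ) : Formula :=
  if h0 : c % 8 = 0 then eq (c / 8).unpair.1 (c / 8).unpair.2
  else if c % 8 = 1 then rel (c / 8).unpair.1 (Denumerable.ofNat (List ℕ) (c / 8).unpair.2)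
  else
    have hc : c / 8 < c := by omega
    have h1 : (c / 8).unpair.1 < c := lt_of_le_of_lt (Nat.unpair_left_le _) hc
    have h2 : (c / 8).unpair.2 < c := lt_of_le_of_lt (Nat.unpair_right_le _) hc
    if c % 8 = 2 then neg (ofNat (c / 8))
    else if c % 8 = 3 then and (ofNat (c / 8).unpair.1) (ofNat (c / 8).unpair.2)
    else if c % 8 = 4 then or (ofNat (c / 8).unpair.1) (ofNat (c / 8).unpair.2)
    else if c % 8 = 5 then imp (ofNat (c / 8).unpair.1) (ofNat (c / 8).unpair.2)
    else if c % 8 = 6 then ex (c / 8).unpair.1 (ofNat (c / 8).unpair.2)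
    else all (c / 8).unpair.1 (ofNat (c / 8).unpair.2)
  termination_by c

theorem ofNat_toNat (φ : Formula) : ofNat (toNat φ) = φ := by
  induction φ with
  | eq x y => rw [ofNat]; simp [toNat]
  | rel n xs =>
    have e : (8 * Nat.pair n (Encodable.encode xs) + 1) / 8
        = Nat.pair n (Encodable.encode xs) := by omega
    rw [ofNat]; simp [toNat, e, Nat.add_mod]
  | neg φ ih =>
    have e : (8 * toNat φ + 2) / 8 = toNat φ := by omega
    rw [ofNat]; simp [toNat, e, Nat.add_mod, ih]
  | and φ ψ ih₁ ih₂ =>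
    have e : (8 * Nat.pair (toNat φ) (toNat ψ) + 3) / 8 = Nat.pair (toNat φ) (toNat ψ) := by omega
    rw [ofNat]; simp [toNat, e, Nat.add_mod, ih₁, ih₂]
  | or φ ψ ih₁ ih₂ =>
    have e : (8 * Nat.pair (toNat φ) (toNat ψ) + 4) / 8 = Nat.pair (toNat φ) (toNat ψ) := by omega
    rw [ofNat]; simp [toNat, e, Nat.add_mod, ih₁, ih₂]
  | imp φ ψ ih₁ ih₂ =>
    have e : (8 * Nat.pair (toNat φ) (toNat ψ) + 5) / 8 = Nat.pair (toNat φ) (toNat ψ) := by omega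
    rw [ofNat]; simp [toNat, e, Nat.add_mod, ih₁, ih₂]
  | ex x φ ih =>
    have e : (8 * Nat.pair x (toNat φ) + 6) / 8 = Nat.pair x (toNat φ) := by omega
    rw [ofNat]; simp [toNat, e, Nat.add_mod, ih]
  | all x φ ih =>
    have e : (8 * Nat.pair x (toNat φ) + 7) / 8 = Nat.pair x (toNat φ) := by omega
    rw [ofNat]; simp [toNat, e, Nat.add_mod, ih]

theorem toNat_ofNat (c : ℕ) : toNat (ofNat c) = c := by
  induction c using Nat.strong_induction_on with
  | _ c ih =>
    have hp := Nat.pair_unpair (c / 8)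
    have hd := Nat.div_add_mod c 8
    by_cases h0 : c % 8 = 0
    · rw [ofNat]; simp [toNat, h0]; omega
    by_cases h1 : c % 8 = 1
    · rw [ofNat]; simp [toNat, h1]; omega
    have hc : c / 8 < c := by omega
    have e0 := ih _ hc
    have e1 := ih _ (lt_of_le_of_lt (Nat.unpair_left_le _) hc)
    have e2 := ih _ (lt_of_le_of_lt (Nat.unpair_right_le _) hc)
    rw [ofNat]
    simp only [h0, h1, dite_false, if_false]
    split_ifs <;> simp only [toNat, e0, e1, e2, hp] <;> omega

/-- Formulas are in effective bijection with the natural numbers; computability of functions on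
formulas refers to this bijection. -/
instance : Denumerable Formula :=
  Denumerable.mk' ⟨toNat, ofNat, ofNat_toNat, toNat_ofNat⟩

/-- Free variables. -/
def freeVars : Formula → Finset ℕ
  | eq x y => {x, y}
  | rel _ xs => xs.toFinset
  | neg φ => freeVars φ
  | and φ ψ => freeVars φ ∪ freeVars ψ
  | or φ ψ => freeVars φ ∪ freeVars ψ
  | imp φ ψ => freeVars φ ∪ freeVars ψ
  | ex x φ => (freeVars φ).erase x
  | all x φ => (freeVars φ).erase x

/-- All variables that occur in a formula, free or bound. -/
def vars : Formula → Finset ℕ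
  | eq x y => {x, y}
  | rel _ xs => xs.toFinset
  | neg φ => vars φ
  | and φ ψ => vars φ ∪ vars ψ
  | or φ ψ => vars φ ∪ vars ψ
  | imp φ ψ => vars φ ∪ vars ψ
  | ex x φ => insert x (vars φ)
  | all x φ => insert x (vars φ)

/-- The predicate symbols that occur in a formula. -/
def sig : Formula → Finset PredSym
  | eq _ _ => ∅
  | rel n xs => {(n, xs.length)}
  | neg φ => sig φ
  | and φ ψ => sig φ ∪ sig ψ
  | or φ ψ => sig φ ∪ sig ψ
  | imp φ ψ => sig φ ∪ sig ψ
  | ex _ φ => sig φ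
  | all _ φ => sig φ

/-- A sentence is a formula without free variables. -/
def IsSentence (φ : Formula) : Prop := freeVars φ = ∅

/-- Existential quantification `∃ y₁ … ∃ yₘ φ` over a block of variables. -/
def exs (ys : List ℕ) (φ : Formula) : Formula := ys.foldr ex φ

/-- Universal quantification `∀ y₁ … ∀ yₘ φ` over a block of variables. -/
def alls (ys : List ℕ) (φ : Formula) : Formula := ys.foldr all φ

/-- Atomic formulas, equalities included. -/
inductive IsAtom : Formula → Prop
  | eq (x y : ℕ) : IsAtom (eq x y)
  | rel (n : ℕ) (xs : List ℕ) : IsAtom (rel n xs)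

/-- The guarded fragment GF: quantification only in the patterns `∀ ys (α → φ)` and `∃ ys (α ∧ φ)`,
where the guard `α` is an atom that contains all variables in `ys` and all free variables
of `φ`. -/
inductive IsGuarded : Formula → Prop
  | eq (x y : ℕ) : IsGuarded (eq x y)
  | rel (n : ℕ) (xs : List ℕ) : IsGuarded (rel n xs)
  | neg {φ : Formula} : IsGuarded φ → IsGuarded (neg φ)
  | and {φ ψ : Formula} : IsGuarded φ → IsGuarded ψ → IsGuarded (and φ ψ)
  | or {φ ψ : Formula} : IsGuarded φ → IsGuarded ψ → IsGuarded (or φ ψ)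
  | imp {φ ψ : Formula} : IsGuarded φ → IsGuarded ψ → IsGuarded (imp φ ψ)
  | exs {α φ : Formula} (ys : List ℕ) : IsAtom α → IsGuarded φ → freeVars φ ⊆ freeVars α →
      (∀ y ∈ ys, y ∈ freeVars α) → IsGuarded (exs ys (and α φ))
  | alls {α φ : Formula} (ys : List ℕ) : IsAtom α → IsGuarded φ → freeVars φ ⊆ freeVars α →
      (∀ y ∈ ys, y ∈ freeVars α) → IsGuarded (alls ys (imp α φ))

end Formula

/-- A relational structure: a nonempty domain, and for each predicate symbol `(n, k)` the relation
that consists of the tuples of length `k` in `interp n`. -/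
structure Struc where
  Dom : Type
  nonempty : Nonempty Dom
  interp : ℕ → Set (List Dom)

/-- Satisfaction of a formula in a structure under an assignment. -/
def Sat (A : Struc) : (ℕ → A.Dom) → Formula → Prop
  | v, .eq x y => v x = v y
  | v, .rel n xs => xs.map v ∈ A.interp n
  | v, .neg φ => ¬ Sat A v φ
  | v, .and φ ψ => Sat A v φ ∧ Sat A v ψ
  | v, .or φ ψ => Sat A v φ ∨ Sat A v ψ
  | v, .imp φ ψ => Sat A v φ → Sat A v ψ
  | v, .ex x φ => ∃ a : A.Dom, Sat A (Function.update v x a) φ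
  | v, .all x φ => ∀ a : A.Dom, Sat A (Function.update v x a) φ

/-- `A` is a model of the sentence `φ`. -/
def IsModel (A : Struc) (φ : Formula) : Prop := ∀ v : ℕ → A.Dom, Sat A v φ

/-- Logical consequence `φ ⊨ ψ` between sentences. -/
def Conseq (φ ψ : Formula) : Prop := ∀ A : Struc, IsModel A φ → IsModel A ψ

/-- The `F`-sentences, for a set `F` of first-order formulas. -/
def sentences (F : Set Formula) : Set Formula := {φ | φ ∈ F ∧ φ.IsSentence}

/-- The `k`-variable guarded fragment: guarded formulas in which only the variables
`0, …, k - 1` occur, over predicate symbols of arities `1, …, k`. -/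
def GF (k : ℕ) : Set Formula :=
  {φ | φ.IsGuarded ∧ (∀ x ∈ φ.vars, x < k) ∧ ∀ p ∈ φ.sig, 1 ≤ p.2 ∧ p.2 ≤ k}

/-- `F` extends `G`: every `G`-sentence can be effectively rewritten into a logically equivalent
`F`-sentence over the same predicate symbols.  This holds in particular if every `G`-sentence is
an `F`-sentence, and it also covers fragments (such as the guarded negation fragment) that contain
`G` up to the choice of the syntax. -/
def Extends (F G : Set Formula) : Prop :=
  ∃ t : Formula → Formula, Computable t ∧ ∀ φ ∈ sentences G,
    t φ ∈ sentences F ∧ (t φ).sig = φ.sig ∧ Conseq φ (t φ) ∧ Conseq (t φ) φ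

theorem Extends.of_subset {F G : Set Formula} (h : sentences G ⊆ F) : Extends F G :=
  ⟨id, Computable.id, fun _ hφ => ⟨⟨h hφ, hφ.2⟩, rfl, fun _ hA => hA, fun _ hA => hA⟩⟩

/-- `φ₁` `F(S)`-entails `φ₂`: every `F`-sentence over the signature `S` that follows from `φ₂`
follows from `φ₁`. -/
def Entails (F : Set Formula) (S : Finset PredSym) (φ₁ φ₂ : Formula) : Prop :=
  ∀ ψ ∈ sentences F, ψ.sig ⊆ S → Conseq φ₂ ψ → Conseq φ₁ ψ

/-- `φ₁` and `φ₂` are `F(S)`-inseparable. -/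
def Inseparable (F : Set Formula) (S : Finset PredSym) (φ₁ φ₂ : Formula) : Prop :=
  Entails F S φ₁ φ₂ ∧ Entails F S φ₂ φ₁

/-- `φ₁ ∧ φ₂` is an `F`-conservative extension of `φ₁`. -/
def ConsExt (F : Set Formula) (φ₁ φ₂ : Formula) : Prop :=
  Entails F φ₁.sig φ₁ (.and φ₁ φ₂)

/-- `φ₁` strongly `F(S)`-entails `φ₂`: it `F(S')`-entails `φ₂` for every signature `S'` with
`S' ∩ sig(φ₂) ⊆ S`. -/
def StronglyEntails (F : Set Formula) (S : Finset PredSym) (φ₁ φ₂ : Formula) : Prop :=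
  ∀ S' : Finset PredSym, S' ∩ φ₂.sig ⊆ S → Entails F S' φ₁ φ₂

/-- The problem to tell, for inputs from `I`, whether `Q` holds is decidable: some algorithm
terminates with the correct answer on every input from `I`.  Nothing is required on other inputs,
so that an undecidable `I` does not make the problem undecidable. -/
def DecidableOn {α : Type} [Primcodable α] (I : Set α) (Q : α → Prop) : Prop :=
  ∃ f : α →. Bool, Partrec f ∧ ∀ a ∈ I, ∃ b ∈ f a, (b = true ↔ Q a)

/-- Inputs of the conservative extension problem: pairs of sentences from `F`. -/
def pairInputs (F : Set Formula) : Set (Formula × Formula) :=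
  {i | i.1 ∈ sentences F ∧ i.2 ∈ sentences F}

/-- Inputs of the other problems: two sentences from `F` and a signature, given as a list. -/
def sigInputs (F : Set Formula) : Set (Formula × Formula × List PredSym) :=
  {i | i.1 ∈ sentences F ∧ i.2.1 ∈ sentences F}

end FOCons

/-!
The halting problem of a fixed universal code `c : Turing.ToPartrec.Code` is reduced to each of the
problems. Only two binary predicates, for left and right edges, belong to the common signature. A
point of a structure can *unfold* to a finite binary tree (`Unfolds`), which a guarded sentence with
two variables can express (`treeFormula`). Lists of numbers are binary trees, and so are
*certificates*: a certificate for `c` has an input, an output, and at most two subcertificates,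
one for each recursive call in the definition of `Code.eval`.

The first sentence is a tautology `base` over the edges. The second sentence, `noCertificate c n`,
says that every point with input `[n]` is *marked* as a defective certificate for `c`, and that each
mark is justified: it leads on to another mark or to a visible defect. Marks are binary predicates
`D_s(x, y)`, one for each state `s` of a search with two pebbles on `x` and `y`. A third variable is
needed to move one pebble while the position of the other one is kept, and a fresh ternary predicate
guards these moves. The state `none` searches for a difference of the trees below the two pebbles,
so that certificates can be compared with their subcertificates although guarded formulas cannot
count.

* If `c` does not halt on `[n]`, then every structure expands to a model of `noCertificate c n`
  (`exists_expansion`): mark all pairs that fail to be sound. A sound certificate with input `[n]`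
  would give a value of `c`, and local correctness implies soundness (`certifies_of_no_defect`).
  Hence no sentence at all over the edges, or over other predicates that are not used for the
  marks, separates the two sentences.
* If `c` halts on `[n]`, then the computation has a finite certificate `t` on which every search
  gets stuck (`exists_certificate`), so that no point of a model of `noCertificate c n` unfolds
  to `t`. This is a guarded sentence with two variables (`noTree`), which fails in the structure of
  all trees.

Rewritings into equivalent sentences of another fragment do not affect these two facts
(`conservativity_iff`).
-/

namespace FOCons

open Turing.ToPartrec

/-! ### Binary trees -/

/-- Binary trees. They serve both as data and as certificates of computations. -/
inductive BinTree : Type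
  | nil
  | node (l r : BinTree)

namespace BinTree

/-- The left (`false`) or right (`true`) subtree, where the empty tree is its own subtree. -/
def child : Bool → BinTree → BinTree
  | _, nil => nil
  | false, node l _ => l
  | true, node _ r => r

@[simp] theorem child_nil (b : Bool) : child b nil = nil := by cases b <;> rfl
@[simp] theorem child_false_node (l r : BinTree) : child false (node l r) = l := rfl
@[simp] theorem child_true_node (l r : BinTree) : child true (node l r) = r := rfl

theorem eq_node_iff {t l r : BinTree} :
    t = node l r ↔ t ≠ nil ∧ t.child false = l ∧ t.child true = r := by
  cases t <;> simp

/-- The subtree reached along a path. -/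
def get : List Bool → BinTree → BinTree
  | [], t => t
  | b :: p, t => get p (t.child b)

/-- A natural number as a left spine. -/
def ofNat : ℕ → BinTree
  | 0 => nil
  | n + 1 => node (ofNat n) nil

/-- A list of natural numbers as a right spine, with the entries as left subtrees. -/
def ofList : List ℕ → BinTree
  | [] => nil
  | n :: v => node (ofNat n) (ofList v)

@[simp] theorem child_false_ofList (v : List ℕ) : child false (ofList v) = ofNat v.headI := by
  cases v <;> rfl

@[simp] theorem child_true_ofList (v : List ℕ) : child true (ofList v) = ofList v.tail := by
  cases v <;> rfl

@[simp] theorem ofNat_eq_nil {n : ℕ} : ofNat n = nil ↔ n = 0 := by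
  cases n <;> simp [ofNat]

@[simp] theorem child_false_ofNat (n : ℕ) : child false (ofNat n) = ofNat (n - 1) := by
  cases n <;> rfl

end BinTree

/-! ### Two-pebble conditions -/

/-- Positive conditions on two pebbles that are placed on the nodes of a graph with left and right
edges. Each condition inspects or moves the first pebble, `swap` exchanges the pebbles, and `dup`
puts the second pebble on the place of the first. -/
inductive Cond (σ : Type) : Type
  | call (s : σ)
  | has (b : Bool)
  | no (b : Bool)
  | go (b : Bool) (C : Cond σ)
  | swap (C : Cond σ)
  | dup (C : Cond σ)
  | and (C C' : Cond σ)
  | or (C C' : Cond σ)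

namespace Cond

variable {σ : Type}

/-- Truth of a condition in a graph with edge relations `e`, where `D s` interprets `call s`.
A move along a missing edge leaves the pebble in place, in accordance with `BinTree.child`. -/
def Holds {α : Type} (e : Bool → α → α → Prop) (D : σ → α → α → Prop) : Cond σ → α → α → Prop
  | call s, a, b => D s a b
  | has i, a, _ => ∃ c, e i a c
  | no i, a, _ => ¬ ∃ c, e i a c
  | go i C, a, b => (∃ c, e i a c ∧ C.Holds e D c b) ∨ ((¬ ∃ c, e i a c) ∧ C.Holds e D a b)
  | swap C, a, b => C.Holds e D b a
  | dup C, a, _ => C.Holds e D a a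
  | and C C', a, b => C.Holds e D a b ∧ C'.Holds e D a b
  | or C C', a, b => C.Holds e D a b ∨ C'.Holds e D a b

theorem Holds.mono {α : Type} {e : Bool → α → α → Prop} {D D' : σ → α → α → Prop}
    (h : ∀ s a b, D s a b → D' s a b) {C : Cond σ} {a b : α} (hC : C.Holds e D a b) :
    C.Holds e D' a b := by
  induction C generalizing a b with
  | call s => exact h s a b hC
  | has i => exact hC
  | no i => exact hC
  | go i C ih => exact hC.imp (fun ⟨c, hc, h⟩ => ⟨c, hc, ih h⟩) (And.imp_right ih)
  | swap C ih => exact ih hC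
  | dup C ih => exact ih hC
  | and C C' ih ih' => exact ⟨ih hC.1, ih' hC.2⟩
  | or C C' ih ih' => exact hC.imp ih ih'

/-- Truth of a condition for pebbles at the roots of two trees. -/
def TreeHolds (D : σ → BinTree → BinTree → Prop) : Cond σ → BinTree → BinTree → Prop
  | call s, t, u => D s t u
  | has _, t, _ => t ≠ .nil
  | no _, t, _ => t = .nil
  | go i C, t, u => C.TreeHolds D (t.child i) u
  | swap C, t, u => C.TreeHolds D u t
  | dup C, t, _ => C.TreeHolds D t t
  | and C C', t, u => C.TreeHolds D t u ∧ C'.TreeHolds D t u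
  | or C C', t, u => C.TreeHolds D t u ∨ C'.TreeHolds D t u

/-- Move the first pebble along a path. -/
def path (p : List Bool) (C : Cond σ) : Cond σ := p.foldr go C

theorem treeHolds_path (D : σ → BinTree → BinTree → Prop) (p : List Bool) (C : Cond σ)
    (t u : BinTree) : (path p C).TreeHolds D t u ↔ C.TreeHolds D (t.get p) u := by
  induction p generalizing t with
  | nil => rfl
  | cons b p ih => exact ih (t.child b)

end Cond

/-- `Unfolds e a t`: the part of the graph that is reachable from `a` unravels, up to
bisimulation, to the finite tree `t`. -/
def Unfolds {α : Type} (e : Bool → α → α → Prop) : α → BinTree → Prop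
  | a, .nil => (¬ ∃ c, e false a c) ∧ ¬ ∃ c, e true a c
  | a, .node l r => ((∃ c, e false a c) ∧ ∀ c, e false a c → Unfolds e c l) ∧
      (∃ c, e true a c) ∧ ∀ c, e true a c → Unfolds e c r

section Unfolds

variable {α σ : Type} {e : Bool → α → α → Prop}

theorem Unfolds.unique {a : α} {t u : BinTree} (ht : Unfolds e a t) (hu : Unfolds e a u) :
    t = u := by
  induction t generalizing a u with
  | nil =>
    cases u with
    | nil => rfl
    | node l r => exact absurd hu.1.1 ht.1
  | node l r ihl ihr =>
    cases u with
    | nil => exact absurd ht.1.1 hu.1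
    | node l' r' =>
      obtain ⟨c, hc⟩ := ht.1.1
      obtain ⟨d, hd⟩ := ht.2.1
      rw [ihl (ht.1.2 c hc) (hu.1.2 c hc), ihr (ht.2.2 d hd) (hu.2.2 d hd)]

theorem Unfolds.exists_edge_iff {a : α} {t : BinTree} (h : Unfolds e a t) (i : Bool) :
    (∃ c, e i a c) ↔ t ≠ .nil := by
  cases t with
  | nil => cases i; exacts [by simpa using h.1, by simpa using h.2]
  | node l r => cases i; exacts [by simpa using h.1.1, by simpa using h.2.1]

theorem Unfolds.child {a c : α} {t : BinTree} (h : Unfolds e a t) {i : Bool} (hc : e i a c) :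
    Unfolds e c (t.child i) := by
  cases t with
  | nil => exact absurd rfl ((h.exists_edge_iff i).1 ⟨c, hc⟩)
  | node l r => cases i; exacts [h.1.2 c hc, h.2.2 c hc]

theorem Unfolds.treeHolds {D : σ → α → α → Prop} {D' : σ → BinTree → BinTree → Prop}
    (hD : ∀ s a b t u, Unfolds e a t → Unfolds e b u → D s a b → D' s t u) (C : Cond σ)
    {a b : α} {t u : BinTree} (ht : Unfolds e a t) (hu : Unfolds e b u) (h : C.Holds e D a b) :
    C.TreeHolds D' t u := by
  induction C generalizing a b t u with
  | call s => exact hD s a b t u ht hu h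
  | has i => exact (ht.exists_edge_iff i).1 h
  | no i => exact not_not.1 (mt (ht.exists_edge_iff i).2 h)
  | go i C ih =>
    rcases h with ⟨c, hc, h⟩ | ⟨hn, h⟩
    · exact ih (ht.child hc) hu h
    · have := not_not.1 (mt (ht.exists_edge_iff i).2 hn)
      subst this
      simpa [Cond.TreeHolds] using ih ht hu h
  | swap C ih => exact ih hu ht h
  | dup C ih => exact ih ht ht h
  | and C C' ih ih' => exact ⟨ih ht hu h.1, ih' ht hu h.2⟩
  | or C C' ih ih' => exact h.imp (ih ht hu) (ih' ht hu)

theorem Unfolds.holds {D : σ → α → α → Prop} {D' : σ → BinTree → BinTree → Prop}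
    (hD : ∀ s a b t u, Unfolds e a t → Unfolds e b u → D' s t u → D s a b) (C : Cond σ)
    {a b : α} {t u : BinTree} (ht : Unfolds e a t) (hu : Unfolds e b u)
    (h : C.TreeHolds D' t u) : C.Holds e D a b := by
  induction C generalizing a b t u with
  | call s => exact hD s a b t u ht hu h
  | has i => exact (ht.exists_edge_iff i).2 h
  | no i => exact mt (ht.exists_edge_iff i).1 (not_not.2 h)
  | go i C ih =>
    by_cases hc : ∃ c, e i a c
    · obtain ⟨c, hc⟩ := hc
      exact Or.inl ⟨c, hc, ih (ht.child hc) hu h⟩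
    · have := not_not.1 (mt (ht.exists_edge_iff i).2 hc)
      subst this
      exact Or.inr ⟨hc, ih ht hu (by simpa [Cond.TreeHolds] using h)⟩
  | swap C ih => exact ih hu ht h
  | dup C ih => exact ih ht ht h
  | and C C' ih ih' => exact ⟨ih ht hu h.1, ih' ht hu h.2⟩
  | or C C' ih ih' => exact h.imp (ih ht hu) (ih' ht hu)

end Unfolds

/-! ### Certificates of computations -/

/-- The path from the root of a certificate to the input. -/
def pIn : List Bool := [false, false]

/-- The path from the root of a certificate to the output. -/
def pOut : List Bool := [false, true]

/-- The path from the root of a certificate to the first subcertificate. -/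
def pFst : List Bool := [true, false]

/-- The path from the root of a certificate to the second subcertificate. -/
def pSnd : List Bool := [true, true]

namespace Cond

/-- The subtrees at `p` and `q` differ. The state `none` stands for different trees. -/
def differ (p q : List Bool) : Cond (Option Code) := dup (path q (swap (path p (call none))))

/-- The subtree at `p` is not a certificate for `c`. -/
def bad (c : Code) (p : List Bool) : Cond (Option Code) := path p (call (some c))

/-- The subtree at `p` is empty. -/
def isNil (p : List Bool) : Cond (Option Code) := path p (no false)

/-- The subtree at `p` is nonempty. -/
def isNode (p : List Bool) : Cond (Option Code) := path p (has false)

end Cond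

open Cond in
/-- The ways in which a tree can locally fail to be a certificate for a code. -/
def localDefect : Code → Cond (Option Code)
  | .zero' => (isNil pOut).or <| (isNode (pOut ++ [false])).or <| differ (pOut ++ [true]) pIn
  | .succ => (isNil pOut).or <| (isNil (pOut ++ [false])).or <| (isNode (pOut ++ [true])).or <|
      (isNode (pOut ++ [false, true])).or <| differ (pOut ++ [false, false]) (pIn ++ [false])
  | .tail => differ pOut (pIn ++ [true])
  | .cons f fs => (bad f pFst).or <| (bad fs pSnd).or <| (differ (pFst ++ pIn) pIn).or <|
      (differ (pSnd ++ pIn) pIn).or <| (isNil pOut).or <|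
      (differ (pOut ++ [false]) (pFst ++ pOut ++ [false])).or <|
      differ (pOut ++ [true]) (pSnd ++ pOut)
  | .comp f g => (bad g pFst).or <| (bad f pSnd).or <| (differ (pFst ++ pIn) pIn).or <|
      (differ (pSnd ++ pIn) (pFst ++ pOut)).or <| differ pOut (pSnd ++ pOut)
  | .case f g => (differ pOut (pFst ++ pOut)).or <|
      ((isNil (pIn ++ [false])).and <| (bad f pFst).or <| differ (pFst ++ pIn) (pIn ++ [true])).or <|
      (isNode (pIn ++ [false])).and <| (bad g pFst).or <| (isNil (pFst ++ pIn)).or <|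
        (differ (pFst ++ pIn ++ [false]) (pIn ++ [false, false])).or <|
        differ (pFst ++ pIn ++ [true]) (pIn ++ [true])
  | .fix f => (bad f pFst).or <| (differ (pFst ++ pIn) pIn).or <|
      ((isNil (pFst ++ pOut ++ [false])).and <| differ pOut (pFst ++ pOut ++ [true])).or <|
      (isNode (pFst ++ pOut ++ [false])).and <| (bad (.fix f) pSnd).or <|
        (differ (pSnd ++ pIn) (pFst ++ pOut ++ [true])).or <| differ pOut (pSnd ++ pOut)

open Cond in
/-- The condition that the state `s` of the defect search leads to. The state `none` looks for a
difference of two trees and `some c` for a defect of a certificate for `c`; nodes that do not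
unfold to a finite tree at all count as different from themselves. -/
def rule : Option Code → Cond (Option Code)
  | none =>
    ((has false).and (no true)).or <| ((no false).and (has true)).or <|
    ((has false).and (swap (no false))).or <| ((no false).and (swap (has false))).or <|
    ((has false).and (swap (no true))).or <| ((no false).and (swap (has true))).or <|
    (has false).and <| (go false (swap (go false (swap (call none))))).or
      (go true (swap (go true (swap (call none)))))
  | some c => (dup (call none)).or <| (swap (dup (call none))).or <| localDefect c

/-- The states that the defect search for a code passes through. -/
def codeStates : Code → List (Option Code)
  | .zero' => [none, some .zero']
  | .succ => [none, some .succ]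
  | .tail => [none, some .tail]
  | .cons f g => some (.cons f g) :: (codeStates f ++ codeStates g)
  | .comp f g => some (.comp f g) :: (codeStates f ++ codeStates g)
  | .case f g => some (.case f g) :: (codeStates f ++ codeStates g)
  | .fix f => some (.fix f) :: codeStates f

theorem none_mem_codeStates (c : Code) : none ∈ codeStates c := by
  induction c <;> simp_all [codeStates]

theorem some_mem_codeStates (c : Code) : some c ∈ codeStates c := by
  cases c <;> simp [codeStates]

open BinTree in
/-- `t` is a correct certificate: if its input encodes a list, then `c` halts on this list, and the
output of `t` encodes the result. -/
def Certifies (c : Code) (t : BinTree) : Prop :=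
  ∀ v, t.get pIn = ofList v → ∃ w ∈ c.eval v, t.get pOut = ofList w

/-- The meaning of the failure of a state of the defect search. -/
def Sound : Option Code → BinTree → BinTree → Prop
  | none, t, u => t = u
  | some c, t, _ => Certifies c t

section
variable (D : Option Code → BinTree → BinTree → Prop) (t u : BinTree)

@[simp] theorem treeHolds_differ (p q : List Bool) :
    (Cond.differ p q).TreeHolds D t u ↔ D none (t.get p) (t.get q) := by
  simp [Cond.differ, Cond.TreeHolds, Cond.treeHolds_path]

@[simp] theorem treeHolds_bad (c : Code) (p : List Bool) :
    (Cond.bad c p).TreeHolds D t u ↔ D (some c) (t.get p) u := by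
  simp [Cond.bad, Cond.TreeHolds, Cond.treeHolds_path]

@[simp] theorem treeHolds_isNil (p : List Bool) :
    (Cond.isNil p).TreeHolds D t u ↔ t.get p = .nil := by
  simp [Cond.isNil, Cond.TreeHolds, Cond.treeHolds_path]

@[simp] theorem treeHolds_isNode (p : List Bool) :
    (Cond.isNode p).TreeHolds D t u ↔ t.get p ≠ .nil := by
  simp [Cond.isNode, Cond.TreeHolds, Cond.treeHolds_path]

@[simp] theorem treeHolds_or (C C' : Cond (Option Code)) :
    (C.or C').TreeHolds D t u ↔ C.TreeHolds D t u ∨ C'.TreeHolds D t u := Iff.rfl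

@[simp] theorem treeHolds_and (C C' : Cond (Option Code)) :
    (C.and C').TreeHolds D t u ↔ C.TreeHolds D t u ∧ C'.TreeHolds D t u := Iff.rfl

end

@[simp] theorem BinTree.get_append (p q : List Bool) (t : BinTree) :
    t.get (p ++ q) = (t.get p).get q := by
  induction p generalizing t with
  | nil => rfl
  | cons b p ih => exact ih _

theorem BinTree.get_singleton (b : Bool) (t : BinTree) : t.get [b] = t.child b := rfl

theorem BinTree.get_pair (b c : Bool) (t : BinTree) : t.get [b, c] = (t.child b).child c := rfl

open BinTree in
/-- A tree without local defects whose subcertificates are correct is itself correct. -/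
theorem certifies_of_no_defect (c : Code) (t u : BinTree)
    (h : ¬ (localDefect c).TreeHolds (fun s t u => ¬ Sound s t u) t u) : Certifies c t := by
  intro v hv
  cases c with
  | zero' =>
    simp only [localDefect, treeHolds_or, treeHolds_isNil, treeHolds_isNode, treeHolds_differ,
      get_append, get_singleton, hv, Sound, not_or, not_not] at h
    exact ⟨0 :: v, by simp, eq_node_iff.2 h⟩
  | succ =>
    simp only [localDefect, treeHolds_or, treeHolds_isNil, treeHolds_isNode, treeHolds_differ,
      get_append, get_singleton, get_pair, hv, Sound, not_or, not_not, child_false_ofList] at h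
    obtain ⟨h1, h2, h3, h4, h5⟩ := h
    exact ⟨[v.headI.succ], by simp, eq_node_iff.2 ⟨h1, eq_node_iff.2 ⟨h2, h5, h4⟩, h3⟩⟩
  | tail =>
    simp only [localDefect, treeHolds_differ,
      get_append, get_singleton, hv, Sound, not_not, child_true_ofList] at h
    exact ⟨v.tail, by simp, h⟩
  | cons f fs =>
    simp only [localDefect, treeHolds_or, treeHolds_isNil, treeHolds_bad, treeHolds_differ,
      get_append, get_singleton, hv, Sound, not_or, not_not] at h
    obtain ⟨hf, hg, h1, h2, h3, h4, h5⟩ := h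
    obtain ⟨w, hw, e⟩ := hf v h1
    obtain ⟨z, hz, e'⟩ := hg v h2
    refine ⟨w.headI :: z, ?_, eq_node_iff.2 ⟨h3, ?_, ?_⟩⟩
    · rw [Code.cons_eval]
      exact Part.mem_bind hw (Part.mem_bind hz (Part.mem_some _))
    · rw [h4, e, child_false_ofList]
    · rw [h5, e']
  | comp f g =>
    simp only [localDefect, treeHolds_or, treeHolds_bad, treeHolds_differ,
      get_append, hv, Sound, not_or, not_not] at h
    obtain ⟨hg, hf, h1, h2, h3⟩ := h
    obtain ⟨w, hw, e⟩ := hg v h1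
    obtain ⟨z, hz, e'⟩ := hf w (h2.trans e)
    refine ⟨z, ?_, h3.trans e'⟩
    rw [Code.comp_eval]
    exact Part.mem_bind hw hz
  | case f g =>
    simp only [localDefect, treeHolds_or, treeHolds_and, treeHolds_isNil, treeHolds_isNode,
      treeHolds_bad, treeHolds_differ, get_append, get_singleton, get_pair, hv, Sound, not_or,
      not_and, not_not, child_false_ofList, child_true_ofList, child_false_ofNat,
      ofNat_eq_nil, ne_eq] at h
    obtain ⟨h1, h2, h3⟩ := h
    rw [Code.case_eval, h1]
    dsimp only
    rcases hn : v.headI with _ | y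
    · obtain ⟨hf, h4⟩ := h2 hn
      exact hf _ h4
    · obtain ⟨hf, h4, h5, h6⟩ := h3 (by omega)
      refine hf (y :: v.tail) (eq_node_iff.2 ⟨h4, ?_, h6⟩)
      rw [h5, hn]; rfl
  | fix f =>
    simp only [localDefect, treeHolds_or, treeHolds_and, treeHolds_isNil, treeHolds_isNode,
      treeHolds_bad, treeHolds_differ, get_append, get_singleton, hv, Sound, not_or,
      not_and, not_not, ne_eq] at h
    obtain ⟨hf, h1, h2, h3⟩ := h
    obtain ⟨w, hw, e⟩ := hf v h1
    simp only [e, child_false_ofList, child_true_ofList, ofNat_eq_nil] at h2 h3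
    rw [Code.fix_eval]
    by_cases h0 : w.headI = 0
    · refine ⟨w.tail, PFun.fix_stop ((Part.mem_map_iff _).2 ⟨w, hw, if_pos h0⟩), h2 h0⟩
    · obtain ⟨hg, h4, h5⟩ := h3 h0
      obtain ⟨z, hz, e'⟩ := hg _ h4
      refine ⟨z, ?_, h5.trans e'⟩
      rw [Code.fix_eval] at hz
      exact PFun.mem_fix_iff.2 (Or.inr ⟨_, (Part.mem_map_iff _).2 ⟨w, hw, if_neg h0⟩, hz⟩)

/-- `D` is closed under the defect search from states in `S`: whatever it marks leads on to further
marks or to a visible defect. -/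
def Searches (S : List (Option Code)) (D : Option Code → BinTree → BinTree → Prop) : Prop :=
  ∀ s ∈ S, ∀ t u, D s t u → (rule s).TreeHolds D t u

/-- A difference of a finite tree from itself is never found, as the search runs out of nodes. -/
theorem Searches.eq_self {S : List (Option Code)} {D : Option Code → BinTree → BinTree → Prop}
    (hD : Searches S D) (hS : none ∈ S) (t : BinTree) : ¬ D none t t := by
  induction t with
  | nil =>
    intro h
    simpa [rule, Cond.TreeHolds] using hD none hS _ _ h
  | node l r ihl ihr =>
    intro h
    simpa [rule, Cond.TreeHolds, ihl, ihr] using hD none hS _ _ h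

theorem Searches.mono {S S' : List (Option Code)} {D : Option Code → BinTree → BinTree → Prop}
    (hD : Searches S D) (h : S' ⊆ S) : Searches S' D := fun s hs => hD s (h hs)

open BinTree in
/-- A halting computation has a certificate on which every defect search fails. -/
theorem exists_certificate (c : Code) (v w : List ℕ) (hw : w ∈ c.eval v) :
    ∃ t : BinTree, t.get pIn = ofList v ∧ t.get pOut = ofList w ∧
      ∀ D, Searches (codeStates c) D → ∀ u, ¬ D (some c) t u := by
  -- By `Searches.eq_self`, marks at a certificate can only come from a local defect.
  have key : ∀ (c : Code) (t : BinTree), (∀ D, Searches (codeStates c) D →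
      (∀ t, ¬ D none t t) → ∀ u, ¬ (localDefect c).TreeHolds D t u) →
      ∀ D, Searches (codeStates c) D → ∀ u, ¬ D (some c) t u := by
    intro c t h D hD u hu
    have h0 := hD.eq_self (none_mem_codeStates c)
    have := hD _ (some_mem_codeStates c) _ _ hu
    simp only [rule, treeHolds_or, Cond.TreeHolds, h0, false_or] at this
    exact h D hD h0 u this
  induction c generalizing v w with
  | zero' =>
    obtain rfl : w = 0 :: v := by simpa using hw
    refine ⟨node (node (ofList v) (ofList (0 :: v))) nil, rfl, rfl, key _ _ ?_⟩
    intro D hD h0 u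
    simp [localDefect, pIn, pOut, BinTree.get, ofList, h0, ofNat]
  | succ =>
    obtain rfl : w = [v.headI.succ] := by simpa using hw
    refine ⟨node (node (ofList v) (ofList [v.headI.succ])) nil, rfl, rfl, key _ _ ?_⟩
    intro D hD h0 u
    simp [localDefect, pIn, pOut, BinTree.get, ofList, h0, ofNat]
  | tail =>
    obtain rfl : w = v.tail := by simpa using hw
    refine ⟨node (node (ofList v) (ofList v.tail)) nil, rfl, rfl, key _ _ ?_⟩
    intro D hD h0 u
    simp [localDefect, pIn, pOut, BinTree.get, h0]
  | cons f fs ihf ihg =>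
    rw [Code.cons_eval] at hw
    obtain ⟨x, hx, hw⟩ := Part.mem_bind_iff.1 hw
    obtain ⟨y, hy, hw⟩ := Part.mem_bind_iff.1 hw
    obtain rfl := Part.mem_some_iff.1 hw
    obtain ⟨t, ht1, ht2, ht⟩ := ihf _ _ hx
    obtain ⟨t', ht1', ht2', ht'⟩ := ihg _ _ hy
    refine ⟨node (node (ofList v) (ofList (x.headI :: y))) (node t t'), rfl, rfl, key _ _ ?_⟩
    intro D hD h0 u
    have h1 := ht D (hD.mono (by simp [codeStates])) u
    have h2 := ht' D (hD.mono (by simp [codeStates])) u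
    simp only [pIn, pOut, BinTree.get] at ht1 ht2 ht1' ht2'
    simp [localDefect, pIn, pOut, pFst, pSnd, BinTree.get, ofList, h0, h1, h2, ht1, ht2, ht1', ht2']
  | comp f g ihf ihg =>
    rw [Code.comp_eval] at hw
    obtain ⟨x, hx, hw⟩ := Part.mem_bind_iff.1 hw
    obtain ⟨t, ht1, ht2, ht⟩ := ihg _ _ hx
    obtain ⟨t', ht1', ht2', ht'⟩ := ihf _ _ hw
    refine ⟨node (node (ofList v) (ofList w)) (node t t'), rfl, rfl, key _ _ ?_⟩
    intro D hD h0 u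
    have h1 := ht D (hD.mono (by simp [codeStates])) u
    have h2 := ht' D (hD.mono (by simp [codeStates])) u
    simp only [pIn, pOut, BinTree.get] at ht1 ht2 ht1' ht2'
    simp [localDefect, pIn, pOut, pFst, pSnd, BinTree.get, h0, h1, h2, ht1, ht2, ht1', ht2']
  | case f g ihf ihg =>
    rw [Code.case_eval] at hw
    dsimp only at hw
    rcases hn : v.headI with _ | y
    · rw [hn] at hw
      obtain ⟨t, ht1, ht2, ht⟩ := ihf _ _ hw
      refine ⟨node (node (ofList v) (ofList w)) (node t nil), rfl, rfl, key _ _ ?_⟩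
      intro D hD h0 u
      have h1 := ht D (hD.mono (by simp [codeStates])) u
      simp only [pIn, pOut, BinTree.get] at ht1 ht2
      simp [localDefect, pIn, pOut, pFst, BinTree.get, h0, h1, hn, ht1, ht2]
    · rw [hn] at hw
      obtain ⟨t, ht1, ht2, ht⟩ := ihg _ _ hw
      refine ⟨node (node (ofList v) (ofList w)) (node t nil), rfl, rfl, key _ _ ?_⟩
      intro D hD h0 u
      have h1 := ht D (hD.mono (by simp [codeStates])) u
      simp only [pIn, pOut, BinTree.get] at ht1 ht2
      simp [localDefect, pIn, pOut, pFst, BinTree.get, h0, h1, hn, ht1, ht2, ofList]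
  | fix f ih =>
    rw [Code.fix_eval] at hw
    refine PFun.fixInduction' (C := fun v => ∃ t : BinTree, t.get pIn = ofList v ∧
      t.get pOut = ofList w ∧ ∀ D, Searches (codeStates (.fix f)) D → ∀ u,
        ¬ D (some (.fix f)) t u) hw (fun v hv => ?_) (fun v v' hv' hv IH => ?_)
    · obtain ⟨x, hx, e⟩ := (Part.mem_map_iff _).1 hv
      obtain ⟨t, ht1, ht2, ht⟩ := ih _ _ hx
      by_cases hz : x.headI = 0
      · rw [if_pos hz] at e
        obtain rfl := Sum.inl.inj e
        refine ⟨node (node (ofList v) (ofList x.tail)) (node t nil), rfl, rfl, key _ _ ?_⟩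
        intro D hD h0 u
        have h1 := ht D (hD.mono (by simp [codeStates])) u
        simp only [pIn, pOut, BinTree.get] at ht1 ht2
        simp [localDefect, pIn, pOut, pFst, BinTree.get, h0, h1, ht1, ht2, hz]
      · simp [hz] at e
    · obtain ⟨x, hx, e⟩ := (Part.mem_map_iff _).1 hv
      obtain ⟨t, ht1, ht2, ht⟩ := ih _ _ hx
      by_cases hz : x.headI = 0
      · simp [hz] at e
      · rw [if_neg hz] at e
        obtain rfl := Sum.inr.inj e
        obtain ⟨t', ht1', ht2', ht'⟩ := IH
        refine ⟨node (node (ofList v) (ofList w)) (node t t'), rfl, rfl, key _ _ ?_⟩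
        intro D hD h0 u
        have h1 := ht D (hD.mono (by simp [codeStates])) u
        have h2 := ht' D hD u
        simp only [pIn, pOut, BinTree.get] at ht1 ht2 ht1' ht2'
        simp [localDefect, pIn, pOut, pFst, pSnd, BinTree.get, h0, h1, h2, hz, ht1, ht2, ht1', ht2']

section
variable {α : Type} {e : Bool → α → α → Prop}

/-- In any graph, marking exactly the pairs that are not sound obeys the rules of the
defect search. -/
theorem rule_holds_of_not_sound (s : Option Code) (a b : α)
    (h : ¬ ∃ t u, Unfolds e a t ∧ Unfolds e b u ∧ Sound s t u) :
    (rule s).Holds e (fun s a b => ¬ ∃ t u, Unfolds e a t ∧ Unfolds e b u ∧ Sound s t u) a b := by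
  cases s with
  | none =>
    by_contra hr
    -- Past the shape tests, both points have no edges at all, or edges of both kinds.
    have hshape := hr
    simp only [rule, Cond.Holds, not_or, not_and] at hshape
    obtain ⟨h1, h2, h3, h4, h5, h6, -⟩ := hshape
    apply h
    by_cases ha : ∃ c, e false a c
    · have hl : ∀ c, e false a c → ∀ d, e false b d →
          ∃ t u, Unfolds e c t ∧ Unfolds e d u ∧ t = u := by
        intro c hc d hd
        by_contra hn
        exact hr (.inr (.inr (.inr (.inr (.inr (.inr
          ⟨ha, .inl (.inl ⟨c, hc, .inl ⟨d, hd, hn⟩⟩)⟩))))))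
      have hr : ∀ c, e true a c → ∀ d, e true b d →
          ∃ t u, Unfolds e c t ∧ Unfolds e d u ∧ t = u := by
        intro c hc d hd
        by_contra hn
        exact hr (.inr (.inr (.inr (.inr (.inr (.inr
          ⟨ha, .inr (.inl ⟨c, hc, .inl ⟨d, hd, hn⟩⟩)⟩))))))
      obtain ⟨d, hd⟩ := not_not.1 (h3 ha)
      obtain ⟨c', hc'⟩ := not_not.1 (h1 ha)
      obtain ⟨d', hd'⟩ := not_not.1 (h5 ha)
      obtain ⟨c, hc⟩ := ha
      obtain ⟨l, _, hl1, hl2, rfl⟩ := hl c hc d hd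
      obtain ⟨r, _, hr1, hr2, rfl⟩ := hr c' hc' d' hd'
      refine ⟨.node l r, .node l r, ⟨⟨⟨c, hc⟩, fun x hx => ?_⟩, ⟨c', hc'⟩, fun x hx => ?_⟩,
        ⟨⟨⟨d, hd⟩, fun x hx => ?_⟩, ⟨d', hd'⟩, fun x hx => ?_⟩, rfl⟩
      · obtain ⟨l', _, h1', h2', rfl⟩ := hl x hx d hd
        rwa [hl2.unique h2']
      · obtain ⟨l', _, h1', h2', rfl⟩ := hr x hx d' hd'
        rwa [hr2.unique h2']
      · obtain ⟨l', _, h1', h2', rfl⟩ := hl c hc x hx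
        rwa [hl1.unique h1']
      · obtain ⟨l', _, h1', h2', rfl⟩ := hr c' hc' x hx
        rwa [hr1.unique h1']
    · exact ⟨.nil, .nil, ⟨ha, h2 ha⟩, ⟨h4 ha, h6 ha⟩, rfl⟩
  | some c =>
    by_cases ha : ∃ t, Unfolds e a t
    · by_cases hb : ∃ u, Unfolds e b u
      · obtain ⟨t, ht⟩ := ha
        obtain ⟨u, hu⟩ := hb
        refine Or.inr (Or.inr (ht.holds (D' := fun s t u => ¬ Sound s t u) ?_ _ hu ?_))
        · rintro s a b t u ht hu hs ⟨t', u', ht', hu', hs'⟩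
          rw [ht'.unique ht, hu'.unique hu] at hs'
          exact hs hs'
        · by_contra hd
          exact h ⟨t, u, ht, hu, certifies_of_no_defect c t u hd⟩
      · exact Or.inr (Or.inl fun ⟨t, _, ht, _, _⟩ => hb ⟨t, ht⟩)
    · exact Or.inl fun ⟨t, _, ht, _, _⟩ => ha ⟨t, ht⟩

end

/-! ### Closure properties of guarded fragments -/

section GF
variable {k : ℕ} {φ ψ α : Formula}

theorem GF.neg (h : φ ∈ GF k) : φ.neg ∈ GF k := ⟨.neg h.1, h.2⟩

theorem GF.and (h : φ ∈ GF k) (h' : ψ ∈ GF k) : φ.and ψ ∈ GF k := by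
  refine ⟨.and h.1 h'.1, fun x hx => ?_, fun p hp => ?_⟩
  · exact (Finset.mem_union.1 hx).elim (h.2.1 x) (h'.2.1 x)
  · exact (Finset.mem_union.1 hp).elim (h.2.2 p) (h'.2.2 p)

theorem GF.or (h : φ ∈ GF k) (h' : ψ ∈ GF k) : φ.or ψ ∈ GF k := by
  obtain ⟨-, h2⟩ := GF.and h h'
  exact ⟨.or h.1 h'.1, h2⟩

theorem GF.imp (h : φ ∈ GF k) (h' : ψ ∈ GF k) : φ.imp ψ ∈ GF k := by
  obtain ⟨-, h2⟩ := GF.and h h'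
  exact ⟨.imp h.1 h'.1, h2⟩

theorem GF.eq {x y : ℕ} (hx : x < k) (hy : y < k) : Formula.eq x y ∈ GF k :=
  ⟨.eq x y, by simp [Formula.vars, hx, hy], by simp [Formula.sig]⟩

theorem GF.rel {n : ℕ} {xs : List ℕ} (hxs : ∀ x ∈ xs, x < k) (h1 : 1 ≤ xs.length)
    (h2 : xs.length ≤ k) : Formula.rel n xs ∈ GF k :=
  ⟨.rel n xs, by simpa [Formula.vars] using hxs, by simp [Formula.sig, h1, h2]⟩

theorem GF.exs (ys : List ℕ) (hα : α.IsAtom) (h : α ∈ GF k) (h' : φ ∈ GF k)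
    (hf : φ.freeVars ⊆ α.freeVars) (hy : ∀ y ∈ ys, y ∈ α.freeVars ∧ y < k) :
    Formula.exs ys (.and α φ) ∈ GF k := by
  refine ⟨.exs ys hα h'.1 hf fun y m => (hy y m).1, ?_⟩
  obtain ⟨-, h2⟩ := GF.and h h'
  clear hf
  induction ys with
  | nil => exact h2
  | cons y ys ih =>
    obtain ⟨h3, h4⟩ := ih fun y m => hy y (List.mem_cons_of_mem _ m)
    refine ⟨fun x hx => ?_, h4⟩
    rcases Finset.mem_insert.1 hx with rfl | hx
    · exact (hy x List.mem_cons_self).2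
    · exact h3 x hx

theorem GF.alls (ys : List ℕ) (hα : α.IsAtom) (h : α ∈ GF k) (h' : φ ∈ GF k)
    (hf : φ.freeVars ⊆ α.freeVars) (hy : ∀ y ∈ ys, y ∈ α.freeVars ∧ y < k) :
    Formula.alls ys (.imp α φ) ∈ GF k := by
  refine ⟨.alls ys hα h'.1 hf fun y m => (hy y m).1, ?_⟩
  obtain ⟨-, h2⟩ := GF.imp h h'
  clear hf
  induction ys with
  | nil => exact h2
  | cons y ys ih =>
    obtain ⟨h3, h4⟩ := ih fun y m => hy y (List.mem_cons_of_mem _ m)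
    refine ⟨fun x hx => ?_, h4⟩
    rcases Finset.mem_insert.1 hx with rfl | hx
    · exact (hy x List.mem_cons_self).2
    · exact h3 x hx

theorem GF.mono {k' : ℕ} (hk : k ≤ k') : GF k ⊆ GF k' := fun _ h =>
  ⟨h.1, fun x hx => (h.2.1 x hx).trans_le hk, fun p hp => (h.2.2 p hp).imp_right (·.trans hk)⟩

end GF

theorem Extends.mono {F G G' : Set Formula} (h : Extends F G) (hG : G' ⊆ G) : Extends F G' := by
  obtain ⟨t, ht, h⟩ := h
  exact ⟨t, ht, fun φ hφ => h φ ⟨hG hφ.1, hφ.2⟩⟩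

/-- Satisfaction depends only on the interpretation of the predicate symbols that occur. -/
theorem sat_congr {X : Type} (hX : Nonempty X) {I J : ℕ → Set (List X)} (φ : Formula)
    (h : ∀ p ∈ φ.sig, ∀ l : List X, l.length = p.2 → (l ∈ I p.1 ↔ l ∈ J p.1)) (v : ℕ → X) :
    Sat ⟨X, hX, I⟩ v φ ↔ Sat ⟨X, hX, J⟩ v φ := by
  induction φ generalizing v with
  | eq x y => rfl
  | rel n xs => exact h (n, xs.length) (by simp [Formula.sig]) _ (by simp)
  | neg φ ih => exact not_congr (ih h v)
  | and φ ψ ih ih' =>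
    exact and_congr (ih (fun p hp => h p (Finset.mem_union_left _ hp)) v)
      (ih' (fun p hp => h p (Finset.mem_union_right _ hp)) v)
  | or φ ψ ih ih' =>
    exact or_congr (ih (fun p hp => h p (Finset.mem_union_left _ hp)) v)
      (ih' (fun p hp => h p (Finset.mem_union_right _ hp)) v)
  | imp φ ψ ih ih' =>
    exact imp_congr (ih (fun p hp => h p (Finset.mem_union_left _ hp)) v)
      (ih' (fun p hp => h p (Finset.mem_union_right _ hp)) v)
  | ex x φ ih => exact exists_congr fun a => ih h _
  | all x φ ih => exact forall_congr' fun a => ih h _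

/-! ### Formulas for trees and for two-pebble conditions -/

/-- The atom for a left (`false`) or right (`true`) edge. -/
def edgeAtom (b : Bool) (x y : ℕ) : Formula := .rel b.toNat [x, y]

/-- The edge relations of a structure. -/
def Struc.edges (A : Struc) (b : Bool) (x y : A.Dom) : Prop := [x, y] ∈ A.interp b.toNat

/-- `x` has an outgoing edge; `y` is an auxiliary variable. -/
def hasEdge (b : Bool) (x y : ℕ) : Formula := .ex y (.and (edgeAtom b x y) (edgeAtom b x y))

theorem sat_edgeAtom {A : Struc} {v : ℕ → A.Dom} {b : Bool} {x y : ℕ} :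
    Sat A v (edgeAtom b x y) ↔ A.edges b (v x) (v y) := Iff.rfl

theorem sat_hasEdge {A : Struc} {v : ℕ → A.Dom} {b : Bool} {x y : ℕ} (h : x ≠ y) :
    Sat A v (hasEdge b x y) ↔ ∃ c, A.edges b (v x) c := by
  simp [hasEdge, Sat, sat_edgeAtom, Function.update_of_ne h]

theorem edgeAtom_mem_GF {k x y : ℕ} (b : Bool) (hk : 2 ≤ k) (hx : x < k) (hy : y < k) :
    edgeAtom b x y ∈ GF k := GF.rel (by simp [hx, hy]) (by simp) (by simpa)

@[simp] theorem freeVars_edgeAtom (b : Bool) (x y : ℕ) : (edgeAtom b x y).freeVars = {x, y} := by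
  simp [edgeAtom, Formula.freeVars]

theorem hasEdge_mem_GF {k x y : ℕ} (b : Bool) (hk : 2 ≤ k) (hx : x < k) (hy : y < k) :
    hasEdge b x y ∈ GF k :=
  GF.exs [y] (.rel _ _) (edgeAtom_mem_GF b hk hx hy) (edgeAtom_mem_GF b hk hx hy) subset_rfl
    (by simp [freeVars_edgeAtom, hy])

theorem freeVars_hasEdge (b : Bool) (x y : ℕ) : (hasEdge b x y).freeVars ⊆ {x} := by
  intro z
  simp [hasEdge, Formula.freeVars, freeVars_edgeAtom]
  tauto

/-- `x` has an outgoing edge and all such edges lead to points that satisfy `φ` (as `y`). -/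
def edgesTo (b : Bool) (x y : ℕ) (φ : Formula) : Formula :=
  .and (hasEdge b x y) (.all y (.imp (edgeAtom b x y) φ))

/-- The two-variable formula that says of `x` that it unfolds to a given tree. -/
def treeFormula : BinTree → ℕ → ℕ → Formula
  | .nil, x, y => .and (.neg (hasEdge false x y)) (.neg (hasEdge true x y))
  | .node l r, x, y =>
    .and (edgesTo false x y (treeFormula l y x)) (edgesTo true x y (treeFormula r y x))

theorem sat_treeFormula {A : Struc} (t : BinTree) {v : ℕ → A.Dom} {x y : ℕ} (h : x ≠ y) :
    Sat A v (treeFormula t x y) ↔ Unfolds A.edges (v x) t := by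
  induction t generalizing v x y with
  | nil => simp only [treeFormula, Sat, sat_hasEdge h, Unfolds]
  | node l r ihl ihr =>
    simp only [treeFormula, edgesTo, Sat, sat_hasEdge h, Unfolds, ihl h.symm, ihr h.symm,
      sat_edgeAtom, Function.update_of_ne h, Function.update_self]

theorem freeVars_treeFormula (t : BinTree) (x y : ℕ) : (treeFormula t x y).freeVars ⊆ {x} := by
  have h := fun b => freeVars_hasEdge b x y
  induction t generalizing x y with
  | nil => exact Finset.union_subset (h _) (h _)
  | node l r ihl ihr =>
    have key : ∀ b φ, φ.freeVars ⊆ {y} → (edgesTo b x y φ).freeVars ⊆ {x} := by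
      intro b φ hφ
      refine Finset.union_subset (h _) fun z hz => ?_
      simp only [Formula.freeVars, freeVars_edgeAtom, Finset.mem_erase, Finset.mem_union,
        Finset.mem_insert, Finset.mem_singleton] at hz
      have := @hφ z
      simp only [Finset.mem_singleton] at this ⊢
      tauto
    exact Finset.union_subset (key _ _ (ihl y x fun b => freeVars_hasEdge b y x))
      (key _ _ (ihr y x fun b => freeVars_hasEdge b y x))

theorem treeFormula_mem_GF {k x y : ℕ} (t : BinTree) (hk : 2 ≤ k) (hx : x < k) (hy : y < k) :
    treeFormula t x y ∈ GF k := by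
  induction t generalizing x y with
  | nil => exact GF.and (GF.neg (hasEdge_mem_GF _ hk hx hy)) (GF.neg (hasEdge_mem_GF _ hk hx hy))
  | node l r ihl ihr =>
    have key : ∀ b φ, φ ∈ GF k → φ.freeVars ⊆ {y} → edgesTo b x y φ ∈ GF k := by
      intro b φ h hφ
      refine GF.and (hasEdge_mem_GF _ hk hx hy)
        (GF.alls [y] (.rel _ _) (edgeAtom_mem_GF b hk hx hy) h (hφ.trans ?_) ?_)
      · simp
      · simp [hy]
    exact GF.and (key _ _ (ihl hy hx) (freeVars_treeFormula l y x))
      (key _ _ (ihr hy hx) (freeVars_treeFormula r y x))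

/-- The predicate symbols for the edges. -/
def edgeSig : Finset PredSym := {(0, 2), (1, 2)}

theorem sig_hasEdge (b : Bool) (x y : ℕ) : (hasEdge b x y).sig ⊆ edgeSig := by
  cases b <;> simp [hasEdge, edgeAtom, Formula.sig, edgeSig]

theorem sig_treeFormula (t : BinTree) (x y : ℕ) : (treeFormula t x y).sig ⊆ edgeSig := by
  have h := fun b => sig_hasEdge b x y
  have h' : ∀ b, (edgeAtom b x y).sig ⊆ edgeSig := fun b => by
    cases b <;> simp [edgeAtom, Formula.sig, edgeSig]
  induction t generalizing x y with
  | nil => exact Finset.union_subset (h _) (h _)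
  | node l r ihl ihr =>
    have hl := ihl y x (fun b => sig_hasEdge b y x) fun b => by
      cases b <;> simp [edgeAtom, Formula.sig, edgeSig]
    have hr := ihr y x (fun b => sig_hasEdge b y x) fun b => by
      cases b <;> simp [edgeAtom, Formula.sig, edgeSig]
    exact Finset.union_subset (Finset.union_subset (h _) (Finset.union_subset (h' _) hl))
      (Finset.union_subset (h _) (Finset.union_subset (h' _) hr))

/-- One of the variables `0`, `1`, `2` that is different from two given variables. -/
def third (u w : ℕ) : ℕ := if 0 ≠ u ∧ 0 ≠ w then 0 else if 1 ≠ u ∧ 1 ≠ w then 1 else 2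

theorem third_spec (u w : ℕ) : u ≠ third u w ∧ w ≠ third u w ∧ third u w < 3 := by
  unfold third; split_ifs <;> omega

/-- The three-variable formula for a two-pebble condition, with the pebbles at `u` and `w`. The
ternary atom in the clause for moves serves as a guard, and is meant to be true of all triples. -/
def Cond.toFormula {σ : Type} (name : σ → ℕ) : Cond σ → ℕ → ℕ → Formula
  | .call s, u, w => .rel (name s) [u, w]
  | .has i, u, w => hasEdge i u (third u w)
  | .no i, u, w => .neg (hasEdge i u (third u w))
  | .go i C, u, w =>
    .or (.ex (third u w) (.and (.rel 0 [u, w, third u w])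
        (.and (edgeAtom i u (third u w)) (C.toFormula name (third u w) w))))
      (.and (.neg (hasEdge i u (third u w))) (C.toFormula name u w))
  | .swap C, u, w => C.toFormula name w u
  | .dup C, u, _ => C.toFormula name u u
  | .and C C', u, w => .and (C.toFormula name u w) (C'.toFormula name u w)
  | .or C C', u, w => .or (C.toFormula name u w) (C'.toFormula name u w)

section toFormula
variable {σ : Type} (name : σ → ℕ)

theorem freeVars_toFormula (C : Cond σ) (u w : ℕ) :
    (C.toFormula name u w).freeVars ⊆ {u, w} := by
  have he : ∀ i u w, (hasEdge i u (third u w)).freeVars ⊆ {u, w} := fun i u w =>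
    (freeVars_hasEdge i u _).trans (by simp)
  induction C generalizing u w with
  | call s => simp [Cond.toFormula, Formula.freeVars]
  | has i => exact he i u w
  | no i => exact he i u w
  | go i C ih =>
    refine Finset.union_subset (fun z hz => ?_) (Finset.union_subset (he i u w) (ih u w))
    have := @ih (third u w) w z
    simp only [Formula.freeVars, freeVars_edgeAtom, Finset.mem_erase, Finset.mem_union,
      Finset.mem_insert, Finset.mem_singleton, List.mem_toFinset, List.mem_cons,
      List.not_mem_nil] at hz this ⊢
    tauto
  | swap C ih => exact (ih w u).trans (by rw [Finset.pair_comm])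
  | dup C ih => exact (ih u u).trans (by simp)
  | and C C' ih ih' => exact Finset.union_subset (ih u w) (ih' u w)
  | or C C' ih ih' => exact Finset.union_subset (ih u w) (ih' u w)

theorem toFormula_mem_GF (C : Cond σ) {u w : ℕ} (hu : u < 3) (hw : w < 3) :
    C.toFormula name u w ∈ GF 3 := by
  have hh : ∀ i u w, u < 3 → hasEdge i u (third u w) ∈ GF 3 := fun i u w hu =>
    hasEdge_mem_GF i (by omega) hu (third_spec u w).2.2
  induction C generalizing u w with
  | call s => exact GF.rel (by simp [hu, hw]) (by simp) (by simp)
  | has i => exact hh i u w hu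
  | no i => exact GF.neg (hh i u w hu)
  | go i C ih =>
    have ht := (third_spec u w).2.2
    refine GF.or (GF.exs [third u w] (.rel _ _) (GF.rel ?_ ?_ ?_)
      (GF.and (edgeAtom_mem_GF i (by omega) hu ht) (ih ht hw)) ?_ ?_)
      (GF.and (GF.neg (hh i u w hu)) (ih hu hw))
    · simp [hu, hw, ht]
    · simp
    · simp
    · refine Finset.union_subset ?_ ((freeVars_toFormula name C _ _).trans ?_) <;>
        intro z <;> simp [freeVars_edgeAtom, Formula.freeVars] <;> tauto
    · simp [Formula.freeVars, ht]
  | swap C ih => exact ih hw hu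
  | dup C ih => exact ih hu hu
  | and C C' ih ih' => exact GF.and (ih hu hw) (ih' hu hw)
  | or C C' ih ih' => exact GF.or (ih hu hw) (ih' hu hw)

/-- The interpretation of the states of a search in a structure. -/
def Struc.marks (A : Struc) (s : σ) (a b : A.Dom) : Prop := [a, b] ∈ A.interp (name s)

variable {name}

theorem holds_of_sat {A : Struc} (C : Cond σ) {v : ℕ → A.Dom} {u w : ℕ}
    (h : Sat A v (C.toFormula name u w)) : C.Holds A.edges (A.marks name) (v u) (v w) := by
  induction C generalizing v u w with
  | call s => exact h
  | has i => exact (sat_hasEdge (third_spec u w).1).1 h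
  | no i => exact fun h' => h ((sat_hasEdge (third_spec u w).1).2 h')
  | go i C ih =>
    obtain ⟨h1, h2, -⟩ := third_spec u w
    rcases h with ⟨c, -, hc, h⟩ | ⟨hn, h⟩
    · refine Or.inl ⟨c, ?_, ?_⟩
      · simpa [sat_edgeAtom, Function.update_of_ne h1] using hc
      · simpa [Function.update_of_ne h2] using ih h
    · exact Or.inr ⟨fun h' => hn ((sat_hasEdge h1).2 h'), ih h⟩
  | swap C ih => exact ih h
  | dup C ih => exact ih h
  | and C C' ih ih' => exact ⟨ih h.1, ih' h.2⟩
  | or C C' ih ih' => exact h.imp ih ih'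

theorem sat_of_holds {A : Struc} (hA : ∀ a b c, [a, b, c] ∈ A.interp 0) (C : Cond σ)
    {v : ℕ → A.Dom} {u w : ℕ} (h : C.Holds A.edges (A.marks name) (v u) (v w)) :
    Sat A v (C.toFormula name u w) := by
  induction C generalizing v u w with
  | call s => exact h
  | has i => exact (sat_hasEdge (third_spec u w).1).2 h
  | no i => exact fun h' => h ((sat_hasEdge (third_spec u w).1).1 h')
  | go i C ih =>
    obtain ⟨h1, h2, -⟩ := third_spec u w
    rcases h with ⟨c, hc, h⟩ | ⟨hn, h⟩
    · refine Or.inl ⟨c, hA _ _ _, ?_, ih ?_⟩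
      · simpa [sat_edgeAtom, Function.update_of_ne h1] using hc
      · simpa [Function.update_of_ne h2] using h
    · exact Or.inr ⟨fun h' => hn ((sat_hasEdge h1).1 h'), ih h⟩
  | swap C ih => exact ih h
  | dup C ih => exact ih h
  | and C C' ih ih' => exact ⟨ih h.1, ih' h.2⟩
  | or C C' ih ih' => exact h.imp ih ih'

end toFormula

/-! ### The two sentences of the reduction -/

/-- A valid sentence over the signature of the edges. -/
def base : Formula :=
  .and (.alls [0, 1] (.imp (edgeAtom false 0 1) (edgeAtom false 0 1)))
    (.alls [0, 1] (.imp (edgeAtom true 0 1) (edgeAtom true 0 1)))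

theorem sat_base (A : Struc) (v : ℕ → A.Dom) : Sat A v base :=
  ⟨fun _ _ h => h, fun _ _ h => h⟩

theorem sig_base : base.sig = edgeSig := rfl

theorem base_mem : base ∈ sentences (GF 3) := by
  refine ⟨GF.and ?_ ?_, rfl⟩ <;>
  exact GF.alls [0, 1] (.rel _ _) (edgeAtom_mem_GF _ (by simp) (by simp) (by simp))
    (edgeAtom_mem_GF _ (by simp) (by simp) (by simp)) subset_rfl (by simp)

/-- The predicate name of a state of the search for defects of certificates for `c`; the names
`0` and `1` belong to the edges. Different states in `codeStates c` have different names; all other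
states share one name. -/
def stateName (c : Code) (s : Option Code) : ℕ := 2 + (codeStates c).idxOf s

/-- The rule of the defect search for one state. -/
def ruleFormula (c : Code) (s : Option Code) : Formula :=
  .alls [0, 1] (.imp (.rel (stateName c s) [0, 1]) ((rule s).toFormula (stateName c) 0 1))

/-- All rules of the defect search. -/
def rules (c : Code) : Formula :=
  (codeStates c).foldr (fun s φ => .and (ruleFormula c s) φ) base

/-- Every element whose input satisfies `χ` is marked as a defective certificate for `c`. -/
def start (c : Code) (χ : Formula) : Formula :=
  .alls [0] (.imp (.eq 0 0) (.imp
    (.ex 1 (.and (edgeAtom false 0 1) (.ex 0 (.and (edgeAtom false 1 0) χ))))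
    (.rel (stateName c (some c)) [0, 0])))

/-- The sentence which says that there is no certificate for `c` on input `[n]`, in the sense that
every candidate is marked as defective. -/
def noCertificate (c : Code) (n : ℕ) : Formula :=
  .and (rules c) (start c (treeFormula (.ofList [n]) 0 1))

theorem rules_mem (c : Code) : rules c ∈ sentences (GF 3) := by
  have h : ∀ S : List (Option Code),
      S.foldr (fun s φ => .and (ruleFormula c s) φ) base ∈ sentences (GF 3) := by
    intro S
    induction S with
    | nil => exact base_mem
    | cons s S ih =>
      have hf := freeVars_toFormula (stateName c) (rule s) 0 1
      refine ⟨GF.and (GF.alls [0, 1] (.rel _ _) (GF.rel ?_ ?_ ?_)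
        (toFormula_mem_GF _ _ (by simp) (by simp)) (hf.trans ?_) ?_) ih.1, ?_⟩
      · simp
      · simp
      · simp
      · simp [Formula.freeVars]
      · simp [Formula.freeVars]
      · have h0 : (ruleFormula c s).freeVars = ∅ := by
          rw [Finset.eq_empty_iff_forall_notMem]
          intro z hz
          have := @hf z
          simp [ruleFormula, Formula.alls, Formula.freeVars] at hz this
          tauto
        have h1 := ih.2
        simp only [Formula.IsSentence, List.foldr_cons, Formula.freeVars] at h1 ⊢
        rw [h0, h1, Finset.empty_union]
  exact h _

theorem noCertificate_mem (c : Code) (n : ℕ) : noCertificate c n ∈ sentences (GF 3) := by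
  set χ := treeFormula (.ofList [n]) 0 1 with hχ
  have h1 : χ.freeVars ⊆ {0} := freeVars_treeFormula _ 0 1
  have h2 : χ ∈ GF 3 := treeFormula_mem_GF _ (by simp) (by simp) (by simp)
  have hi : (Formula.ex 0 (.and (edgeAtom false 1 0) χ)).freeVars ⊆ {1} := by
    intro z hz
    have := @h1 z
    simp [Formula.freeVars, freeVars_edgeAtom] at hz this ⊢
    tauto
  have hi2 : (Formula.ex 1 (.and (edgeAtom false 0 1)
      (.ex 0 (.and (edgeAtom false 1 0) χ)))).freeVars ⊆ {0} := by
    intro z hz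
    have := @hi z
    simp [Formula.freeVars, freeVars_edgeAtom] at hz this ⊢
    tauto
  refine ⟨GF.and (rules_mem c).1 (GF.alls [0] (.eq _ _) (GF.eq (by simp) (by simp)) (GF.imp
    (GF.exs [1] (.rel _ _) (edgeAtom_mem_GF _ (by simp) (by simp) (by simp))
      (GF.exs [0] (.rel _ _) (edgeAtom_mem_GF _ (by simp) (by simp) (by simp)) h2 ?_ ?_) ?_ ?_)
      (GF.rel (by simp) (by simp) (by simp))) (Finset.union_subset ?_ ?_) ?_), ?_⟩
  · exact h1.trans (by simp)
  · simp
  · exact hi.trans (by simp)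
  · simp
  · exact hi2.trans (by simp [Formula.freeVars])
  · simp [Formula.freeVars]
  · simp [Formula.freeVars]
  · refine Finset.union_eq_empty.2 ⟨(rules_mem c).2, ?_⟩
    rw [Finset.eq_empty_iff_forall_notMem]
    intro z hz
    have := @hi2 z
    simp only [start, ← hχ, Formula.alls, List.foldr, Formula.freeVars, Finset.mem_erase,
      Finset.mem_union] at hz this
    simp at hz this
    tauto

theorem sat_rules {A : Struc} {c : Code} {v : ℕ → A.Dom} :
    Sat A v (rules c) ↔ ∀ s ∈ codeStates c, ∀ a b, A.marks (stateName c) s a b →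
      Sat A (Function.update (Function.update v 0 a) 1 b)
        ((rule s).toFormula (stateName c) 0 1) := by
  unfold rules
  induction codeStates c with
  | nil => simpa using sat_base A v
  | cons s S ih =>
    rw [List.forall_mem_cons, ← ih]
    simp [ruleFormula, Formula.alls, Sat, Struc.marks]

theorem sat_start {A : Struc} {c : Code} {t : BinTree} {v : ℕ → A.Dom} :
    Sat A v (start c (treeFormula t 0 1)) ↔ ∀ a,
      (∃ b, A.edges false a b ∧ ∃ d, A.edges false b d ∧ Unfolds A.edges d t) →
      A.marks (stateName c) (some c) a a := by
  simp [start, Formula.alls, Sat, sat_treeFormula, sat_edgeAtom, Struc.marks]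

/-! ### Halting and expansions -/

/-- If `c` does not halt on `[n]`, then every structure becomes a model of `noCertificate c n` by a
change of relations other than the edges. -/
theorem exists_expansion {c : Code} {n : ℕ} (hn : ¬ (c.eval [n]).Dom) (A : Struc) :
    ∃ I : ℕ → Set (List A.Dom),
      (∀ p ∈ edgeSig, ∀ l : List A.Dom, l.length = p.2 → (l ∈ I p.1 ↔ l ∈ A.interp p.1)) ∧
      IsModel ⟨A.Dom, A.nonempty, I⟩ (noCertificate c n) := by
  -- Marked are the pairs that are not sound; the guard of the moves is true of all triples.
  let D : Option Code → A.Dom → A.Dom → Prop := fun s a b =>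
    ¬ ∃ t u, Unfolds A.edges a t ∧ Unfolds A.edges b u ∧ Sound s t u
  let I : ℕ → Set (List A.Dom) := fun m => {l | l.length = 3 ∨ (m < 2 ∧ l ∈ A.interp m) ∨
    ∃ s a b, m = stateName c s ∧ l = [a, b] ∧ D s a b}
  have hlt : ∀ s, 2 ≤ stateName c s := fun s => Nat.le_add_right _ _
  have hE : ∀ m < 2, ∀ l : List A.Dom, l.length = 2 → (l ∈ I m ↔ l ∈ A.interp m) := by
    intro m hm l hl
    have : ∀ s, m ≠ stateName c s := fun s h => by have := hlt s; omega
    simp only [I, Set.mem_ofPred_eq, hl, hm, this, false_and, exists_false, true_and, or_false]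
    simp
  let B : Struc := ⟨A.Dom, A.nonempty, I⟩
  have hedges : B.edges = A.edges := by
    funext b x y
    exact propext (hE b.toNat (by cases b <;> simp) _ rfl)
  have hD : ∀ s a b, D s a b → B.marks (stateName c) s a b := fun s a b h =>
    Or.inr (Or.inr ⟨s, a, b, rfl, rfl, h⟩)
  -- The converse needs a state that does not share its name.
  have hD' : ∀ s ∈ codeStates c, ∀ a b, B.marks (stateName c) s a b → D s a b := by
    rintro s hs a b (h | ⟨h, -⟩ | ⟨s', a', b', e, e', h⟩)
    · simp at h
    · have := hlt s; omega
    · obtain ⟨rfl, rfl⟩ : a = a' ∧ b = b' := by simpa using e'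
      have : s = s' := (List.idxOf_inj hs).1 (by simpa [stateName] using e)
      rwa [this]
  refine ⟨I, ?_, fun v => ⟨(sat_rules (A := B)).2 fun s hs a b h => ?_,
    (sat_start (A := B)).2 fun a ⟨b, hb, d, hd, h⟩ => hD _ _ _ ?_⟩⟩
  · simp only [edgeSig, Finset.mem_insert, Finset.mem_singleton]
    rintro p (rfl | rfl) l hl
    exacts [hE 0 (by simp) l hl, hE 1 (by simp) l hl]
  · refine sat_of_holds (A := B) (fun _ _ _ => Or.inl rfl) _ ?_
    rw [hedges]
    exact (rule_holds_of_not_sound s a b (hD' s hs a b h)).mono hD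
  · rintro ⟨t, u, ht, -, hs⟩
    rw [hedges] at hb hd h
    obtain ⟨w, hw, -⟩ := hs [n] (((ht.child hb).child hd).unique h)
    exact hn (Part.dom_iff_mem.2 ⟨w, hw⟩)

/-- In a model of the rules, the marks at points that unfold to trees obey the rules on trees. -/
theorem searches_of_model {A : Struc} {c : Code} (hA : IsModel A (rules c)) :
    Searches (codeStates c) fun s t u => ∃ a b, Unfolds A.edges a t ∧ Unfolds A.edges b u ∧
      A.marks (stateName c) s a b := by
  rintro s hs t u ⟨a, b, ha, hb, h⟩
  obtain ⟨x⟩ := A.nonempty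
  exact ha.treeHolds (fun s a b t u ha hb h => ⟨a, b, ha, hb, h⟩) _ hb
    (holds_of_sat _ (sat_rules.1 (hA fun _ => x) s hs a b h))

/-- There is no element that unfolds to the given tree. -/
def noTree (t : BinTree) : Formula := .neg (.exs [0] (.and (.eq 0 0) (treeFormula t 0 1)))

theorem noTree_mem (t : BinTree) : noTree t ∈ sentences (GF 2) := by
  have h := freeVars_treeFormula t 0 1
  refine ⟨GF.neg (GF.exs [0] (.eq _ _) (GF.eq (by simp) (by simp))
    (treeFormula_mem_GF t le_rfl (by simp) (by simp)) (h.trans ?_) ?_), ?_⟩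
  · simp [Formula.freeVars]
  · simp [Formula.freeVars]
  · rw [Formula.IsSentence, Finset.eq_empty_iff_forall_notMem]
    intro z hz
    have := @h z
    simp [noTree, Formula.exs, Formula.freeVars] at hz this
    tauto

theorem sig_noTree (t : BinTree) : (noTree t).sig ⊆ edgeSig :=
  Finset.union_subset (Finset.empty_subset _) (sig_treeFormula t 0 1)

theorem sat_noTree {A : Struc} {v : ℕ → A.Dom} {t : BinTree} :
    Sat A v (noTree t) ↔ ¬ ∃ a, Unfolds A.edges a t := by
  simp [noTree, Formula.exs, Sat, sat_treeFormula]

/-- The structure whose elements are the trees, with edges from trees to their subtrees. -/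
def treeStruc : Struc where
  Dom := BinTree
  nonempty := ⟨.nil⟩
  interp m := {l | ∃ t b, t ≠ .nil ∧ m = b.toNat ∧ l = [t, t.child b]}

theorem treeStruc_edges :
    treeStruc.edges = fun b (t u : BinTree) => t ≠ .nil ∧ u = t.child b := by
  funext b t u
  refine propext ⟨?_, ?_⟩
  · rintro ⟨t', b', h, hb, e⟩
    obtain rfl : b = b' := by cases b <;> cases b' <;> simp at hb ⊢
    obtain ⟨rfl, e⟩ := List.cons.inj e
    exact ⟨h, (List.cons.inj e).1⟩
  · rintro ⟨h, rfl⟩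
    exact ⟨t, b, h, rfl, rfl⟩

theorem unfolds_treeStruc (t : BinTree) : Unfolds treeStruc.edges t t := by
  rw [treeStruc_edges]
  induction t with
  | nil => exact ⟨fun ⟨_, h, _⟩ => h rfl, fun ⟨_, h, _⟩ => h rfl⟩
  | node l r ihl ihr =>
    refine ⟨⟨⟨l, by simp, rfl⟩, ?_⟩, ⟨r, by simp, rfl⟩, ?_⟩
    · rintro _ ⟨-, rfl⟩; exact ihl
    · rintro _ ⟨-, rfl⟩; exact ihr

/-- If `c` halts on `[n]`, then `noCertificate c n` excludes some tree, by a two-variable guarded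
sentence over the edges. -/
theorem exists_noTree {c : Code} {n : ℕ} (hn : (c.eval [n]).Dom) :
    ∃ t, Conseq (noCertificate c n) (noTree t) := by
  obtain ⟨w, hw⟩ := Part.dom_iff_mem.1 hn
  obtain ⟨t, ht, -, h⟩ := exists_certificate c _ _ hw
  refine ⟨t, fun A hA v => sat_noTree.2 ?_⟩
  rintro ⟨a, ha⟩
  refine h _ (searches_of_model fun v => (hA v).1) t ⟨a, a, ha, ha, sat_start.1 (hA v).2 a ?_⟩
  -- The input is nonempty, hence reached by actual edges.
  have h1 : t.child false ≠ .nil := by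
    intro e; simp [pIn, BinTree.get, e, BinTree.ofList] at ht
  have h0 : t ≠ .nil := by rintro rfl; simp at h1
  obtain ⟨b, hb⟩ := (ha.exists_edge_iff false).2 h0
  obtain ⟨d, hd⟩ := ((ha.child hb).exists_edge_iff false).2 h1
  exact ⟨b, hb, d, hd, ht ▸ (ha.child hb).child hd⟩

/-! ### Computability of the reduction -/

/-- Some fixed code has an undecidable halting problem. -/
theorem exists_universal_code :
    ∃ c : Code, ¬ ComputablePred fun n : ℕ => (c.eval [n]).Dom := by
  let f : ℕ →. ℕ := fun n => Nat.Partrec.Code.eval (Denumerable.ofNat Nat.Partrec.Code n) 0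
  have hf : Partrec f :=
    Nat.Partrec.Code.eval_part.comp (Computable.ofNat _) (Computable.const 0)
  obtain ⟨c, hc⟩ := Code.exists_code (Nat.Partrec'.part_iff₁.2 hf)
  refine ⟨c, fun h => ComputablePred.halting_problem 0 ?_⟩
  have hdom : ∀ n : ℕ, (c.eval [n]).Dom ↔ (f n).Dom := fun n => by
    have := hc (n ::ᵥ List.Vector.nil)
    rw [show (n ::ᵥ List.Vector.nil : List.Vector ℕ 1).1 = [n] from rfl] at this
    rw [this]; rfl
  obtain ⟨d, hd, e⟩ := ComputablePred.computable_iff.1 h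
  refine ComputablePred.computable_iff.2 ⟨_, hd.comp Computable.encode, funext fun p => ?_⟩
  have := congrFun e (Encodable.encode p)
  rw [← this, hdom]
  simp [f]

section Primrec
variable {α : Type} [Primcodable α] {f g : α → Formula}

theorem primrec_formula_iff : Primrec f ↔ Primrec fun a => (f a).toNat :=
  Primrec.encode_iff.symm

theorem primrec_toNat (hf : Primrec f) : Primrec fun a => (f a).toNat := primrec_formula_iff.1 hf

theorem primrec_binary (op : Formula → Formula → Formula) (k : ℕ)
    (hop : ∀ φ ψ, (op φ ψ).toNat = 8 * Nat.pair φ.toNat ψ.toNat + k)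
    (hf : Primrec f) (hg : Primrec g) : Primrec fun a => op (f a) (g a) := by
  rw [primrec_formula_iff]
  simp only [hop]
  exact Primrec.nat_add.comp (Primrec.nat_mul.comp (Primrec.const 8)
    (Primrec₂.natPair.comp (primrec_toNat hf) (primrec_toNat hg))) (Primrec.const k)

theorem primrec_and (hf : Primrec f) (hg : Primrec g) : Primrec fun a => (f a).and (g a) :=
  primrec_binary .and 3 (fun _ _ => rfl) hf hg

theorem primrec_imp (hf : Primrec f) (hg : Primrec g) : Primrec fun a => (f a).imp (g a) :=
  primrec_binary .imp 5 (fun _ _ => rfl) hf hg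

theorem primrec_quantifier (op : ℕ → Formula → Formula) (k x : ℕ)
    (hop : ∀ x φ, (op x φ).toNat = 8 * Nat.pair x φ.toNat + k) (hf : Primrec f) :
    Primrec fun a => op x (f a) := by
  rw [primrec_formula_iff]
  simp only [hop]
  exact Primrec.nat_add.comp (Primrec.nat_mul.comp (Primrec.const 8)
    (Primrec₂.natPair.comp (Primrec.const x) (primrec_toNat hf))) (Primrec.const k)

theorem primrec_ex (x : ℕ) (hf : Primrec f) : Primrec fun a => (f a).ex x :=
  primrec_quantifier .ex 6 x (fun _ _ => rfl) hf

theorem primrec_all (x : ℕ) (hf : Primrec f) : Primrec fun a => (f a).all x :=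
  primrec_quantifier .all 7 x (fun _ _ => rfl) hf

theorem primrec_edgesTo (b : Bool) (x y : ℕ) (hf : Primrec f) :
    Primrec fun a => edgesTo b x y (f a) :=
  primrec_and (Primrec.const _) (primrec_all y (primrec_imp (Primrec.const _) hf))

end Primrec

/-- The formulas for numerals, with both choices of the free variable, since these alternate in the
recursion. -/
theorem primrec_treeFormula_ofNat : Primrec fun n : ℕ =>
    (treeFormula (.ofNat n) 0 1, treeFormula (.ofNat n) 1 0) := by
  let step (x y : ℕ) (φ : Formula) : Formula :=
    .and (edgesTo false x y φ) (edgesTo true x y (treeFormula .nil y x))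
  have hstep : ∀ x y, Primrec (step x y) := fun x y =>
    primrec_and (primrec_edgesTo _ _ _ Primrec.id) (Primrec.const _)
  have := Primrec.nat_rec₁ (treeFormula .nil 0 1, treeFormula .nil 1 0)
    (f := fun _ (p : Formula × Formula) => (step 0 1 p.2, step 1 0 p.1))
    (Primrec.pair ((hstep 0 1).comp (Primrec.snd.comp Primrec.snd))
      ((hstep 1 0).comp (Primrec.fst.comp Primrec.snd)))
  refine this.of_eq fun n => ?_
  induction n with
  | zero => rfl
  | succ n ih => simp only [ih]; rfl

theorem primrec_noCertificate (c : Code) : Primrec (noCertificate c) := by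
  have h : Primrec fun n : ℕ => treeFormula (.ofList [n]) 0 1 :=
    primrec_and (primrec_edgesTo _ _ _ (Primrec.snd.comp primrec_treeFormula_ofNat))
      (Primrec.const _)
  exact primrec_and (Primrec.const _) (primrec_all 0 (primrec_imp (Primrec.const _)
    (primrec_imp (primrec_ex 1 (primrec_and (Primrec.const _)
      (primrec_ex 0 (primrec_and (Primrec.const _) h)))) (Primrec.const _))))

theorem computablePred_of_decidableOn {α : Type} [Primcodable α] {I : Set α} {Q : α → Prop}
    (h : DecidableOn I Q) {g : ℕ → α} (hg : Computable g) (hI : ∀ n, g n ∈ I) :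
    ComputablePred fun n => Q (g n) := by
  classical
  obtain ⟨f, hf, h⟩ := h
  refine ⟨Classical.decPred _, (hf.comp hg).of_eq fun n => ?_⟩
  obtain ⟨b, hb, e⟩ := h (g n) (hI n)
  rw [Part.eq_some_iff.2 hb]
  congr 1
  rw [Bool.eq_iff_iff, e]
  simp

/-! ### Entailment and halting -/

section
variable {F : Set Formula} {c : Code} {n : ℕ} {φ₁ φ₂ : Formula}

theorem stronglyEntails_of_not_halts (hn : ¬ (c.eval [n]).Dom)
    (hsig : φ₂.sig = (noCertificate c n).sig) (h₂ : Conseq (noCertificate c n) φ₂) :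
    StronglyEntails F edgeSig φ₁ φ₂ := by
  intro S hS ψ _ hψ h A _ v
  obtain ⟨I, hI, hM⟩ := exists_expansion hn A
  -- Keep the given structure outside the signature of `φ₂`.
  let J : ℕ → Set (List A.Dom) := fun m =>
    {l | ((m, l.length) ∈ φ₂.sig ∧ l ∈ I m) ∨ ((m, l.length) ∉ φ₂.sig ∧ l ∈ A.interp m)}
  have hJ : IsModel ⟨A.Dom, A.nonempty, J⟩ (noCertificate c n) := fun v =>
    (sat_congr A.nonempty _ (fun p hp l hl => by
      rw [← hsig, ← Prod.eta p, ← hl] at hp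
      simp [J, hp]) v).1 (hM v)
  refine (sat_congr A.nonempty ψ (fun p hp l hl => ?_) v).1 (h _ (h₂ _ hJ) v)
  by_cases hp₂ : (p.1, l.length) ∈ φ₂.sig
  · have hp₂' : p ∈ φ₂.sig := by rwa [hl] at hp₂
    have := hI p (hS (Finset.mem_inter.2 ⟨hψ hp, hp₂'⟩)) l hl
    simp [J, hp₂, this]
  · simp [J, hp₂]

/-- The rewriting of `noTree t` into `F` is a separating sentence. -/
theorem not_entails_of_halts (hF : Extends F (GF 2)) (hn : (c.eval [n]).Dom)
    (h₁ : Conseq base φ₁) (h₂ : Conseq φ₂ (noCertificate c n)) :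
    ¬ Entails F edgeSig φ₁ φ₂ := by
  intro h
  obtain ⟨t, ht⟩ := exists_noTree hn
  obtain ⟨r, -, hr⟩ := hF
  obtain ⟨hmem, hs, hto, hfrom⟩ := hr _ (noTree_mem t)
  have := hfrom _ (h _ hmem (hs ▸ sig_noTree t) (fun A hA => hto A (ht A (h₂ A hA))) treeStruc
    (h₁ _ (sat_base _))) fun _ => .nil
  exact sat_noTree.1 this ⟨t, unfolds_treeStruc t⟩

theorem StronglyEntails.entails (h : StronglyEntails F edgeSig φ₁ φ₂) :
    Entails F edgeSig φ₁ φ₂ := h _ Finset.inter_subset_left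

/-- For sentences equivalent to `base` and `noCertificate c n`, each of the four relations holds if
and only if `c` does not halt on `[n]`. -/
theorem conservativity_iff (hF : Extends F (GF 2)) (hsig₁ : φ₁.sig = edgeSig)
    (hsig : φ₂.sig = (noCertificate c n).sig) (h₁ : Conseq base φ₁)
    (h₂ : Conseq (noCertificate c n) φ₂) (h₂' : Conseq φ₂ (noCertificate c n)) :
    (ConsExt F φ₁ φ₂ ↔ ¬ (c.eval [n]).Dom) ∧
    (Inseparable F edgeSig φ₁ φ₂ ↔ ¬ (c.eval [n]).Dom) ∧
    (Entails F edgeSig φ₁ φ₂ ↔ ¬ (c.eval [n]).Dom) ∧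
    (StronglyEntails F edgeSig φ₁ φ₂ ↔ ¬ (c.eval [n]).Dom) := by
  have hvalid : ∀ A, IsModel A φ₁ := fun A => h₁ A (sat_base A)
  have pos := fun hn => stronglyEntails_of_not_halts (F := F) (φ₁ := φ₁) hn hsig h₂
  have neg : ∀ φ, Conseq φ φ₂ → Entails F edgeSig φ₁ φ → ¬ (c.eval [n]).Dom := fun φ hφ h hn =>
    not_entails_of_halts hF hn h₁ (fun A hA => h₂' A (hφ A hA)) h
  refine ⟨?_, ⟨fun h => neg _ (fun _ => id) h.1, fun hn => ⟨(pos hn).entails, ?_⟩⟩,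
    ⟨neg _ fun _ => id, fun hn => (pos hn).entails⟩,
    ⟨fun h => neg _ (fun _ => id) h.entails, pos⟩⟩
  · rw [ConsExt, hsig₁]
    refine ⟨neg _ fun A hA v => (hA v).2, fun hn ψ hψ hs h => ?_⟩
    exact (pos hn).entails ψ hψ hs fun A hA => h A fun v => ⟨hvalid A v, hA v⟩
  · exact fun ψ _ _ h A _ => h A (hvalid A)

end

end FOCons

open FOCons in
theorem mainTheorem2 :
    (∀ F : Set Formula, Extends F (GF 3) →
      ¬ DecidableOn (pairInputs F) (fun i => ConsExt F i.1 i.2) ∧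
      ¬ DecidableOn (sigInputs F) (fun i => Inseparable F i.2.2.toFinset i.1 i.2.1) ∧
      ¬ DecidableOn (sigInputs F) (fun i => Entails F i.2.2.toFinset i.1 i.2.1) ∧
      ¬ DecidableOn (sigInputs F) (fun i => StronglyEntails F i.2.2.toFinset i.1 i.2.1)) ∧
    (∀ W : Set Formula, Extends W (GF 2) →
      ¬ DecidableOn (pairInputs (GF 3)) (fun i => ConsExt W i.1 i.2)) := by
  obtain ⟨c, hc⟩ := exists_universal_code
  have hcomp := (primrec_noCertificate c).to_comp
  -- A decision on the reduced inputs would decide the complement of the halting set.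
  have key : ∀ {P : ℕ → Prop}, ComputablePred P → (∀ n, P n ↔ ¬ (c.eval [n]).Dom) → False :=
    fun hP h => hc (hP.not.of_eq fun n => by rw [h n, not_not])
  have hlist : ([(0, 2), (1, 2)] : List PredSym).toFinset = edgeSig := rfl
  refine ⟨fun F hF => ?_, fun W hW h => ?_⟩
  · have hF₂ := hF.mono (GF.mono (by decide : 2 ≤ 3))
    obtain ⟨t, ht, h⟩ := hF
    obtain ⟨hb, hbs, hb', -⟩ := h _ base_mem
    have hiff := fun n =>
      have hθ := h _ (noCertificate_mem c n)
      conservativity_iff hF₂ (hbs.trans sig_base) hθ.2.1 hb' hθ.2.2.1 hθ.2.2.2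
    have hpair : Computable fun n => (t base, t (noCertificate c n)) :=
      (Computable.const _).pair (ht.comp hcomp)
    have hsig : Computable fun n =>
        (t base, t (noCertificate c n), ([(0, 2), (1, 2)] : List PredSym)) :=
      (Computable.const _).pair ((ht.comp hcomp).pair (Computable.const _))
    have hmem := fun n => (h _ (noCertificate_mem c n)).1
    refine ⟨fun hd => ?_, fun hd => ?_, fun hd => ?_, fun hd => ?_⟩
    · exact key (computablePred_of_decidableOn hd hpair fun n => ⟨hb, hmem n⟩)
        fun n => (hiff n).1
    · exact key (computablePred_of_decidableOn hd hsig fun n => ⟨hb, hmem n⟩)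
        fun n => (hiff n).2.1
    · exact key (computablePred_of_decidableOn hd hsig fun n => ⟨hb, hmem n⟩)
        fun n => (hiff n).2.2.1
    · exact key (computablePred_of_decidableOn hd hsig fun n => ⟨hb, hmem n⟩)
        fun n => (hiff n).2.2.2
  · exact key (computablePred_of_decidableOn h ((Computable.const base).pair hcomp)
      fun n => ⟨base_mem, noCertificate_mem c n⟩) fun n =>
        (conservativity_iff hW sig_base rfl (fun _ => id) (fun _ => id) fun _ => id).1
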